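/- **Max-product BP for maximum-weight perfect bipartite matching.** Let $w=(w_{ij})_{1\le i,j\le n}$ be real weights on the edges $(u_i,v_j)$ of the complete bipartite graph $K_{n,n}$. Bayati et al.'s algorithm sends messages $\vec m^t_{ij}(r)$ from $u_i$ to $v_j$ and $\overleftarrow m^t_{ji}(r)$ from $v_j$ to $u_i$, for $1\le r\le n$. The initial messages are $\vec m^0_{ij}(r)=w_{ij}$ if $r=i$ and $0$ otherwise, and $\overleftarrow m^0_{ji}(r)=w_{ij}$ if $r=j$ and $0$ otherwise. For $t\ge 1$, $$\vec m^t_{ij}(r)=\begin{cases} w_{ij}+\sum_{k\ne j}\overleftarrow m^{t-1}_{ki}(j) & r=i,\\ \max_{q\neq j}\bigl[w_{iq}+\sum_{k\ne j}\overleftarrow m^{t-1}_{ki}(q)\bigr] & r\neq i,\end{cases}\qquad \overleftarrow m^t_{ji}(r)=\begin{cases} w_{ij}+\sum_{k\ne i}\vec m^{t-1}_{kj}(i) & r=j,\\ \max_{q\neq i}\bigl[w_{qj}+\sum_{k\ne i}\vec m^{t-1}_{kj}(q)\bigr] & r\neq j.\end{cases}$$ The belief of $u_i$ is $b^t_{u_i}(r)=w_{ir}+\sum_k\overleftarrow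 m^t_{ki}(r)$, and the estimate $\tilde M^t$ matches each $u_i$ to the $v_r$ that maximizes $b^t_{u_i}(r)$. Let $\tau\in\mathbb N\cup\{\infty\}$ be the least $T$ such that for all $s\ge T$ the estimate $\tilde M^s$ equals the maximum-weight perfect matching $M^\star$ of $K_{n,n}$, however ties among maximizers are broken ($\tau=\infty$ if there is no such $T$, in particular if $M^\star$ is not unique). **Theorem.** There is an absolute constant $C>0$ such that the following holds. Let $G=(U\cup V,E)$ be any bipartite graph with $|U|=|V|=n$ and $|E|=m$. Let the weights $w_e$, $e\in E$, be independent random variables, where $w_e$ has a probability density $f_e:[0,1]\to[0,\phi]$. Run the algorithm on $K_{n,n}$, where the edges missing in $G$ have weight $0$. Then for every integer $t\ge 1$ $$\Pr\bigl(\text{the maximum-weight perfect matching is unique and }\tau\ge t\bigr)\le C\,\frac{nm\phi}{t}.$$ If $G=K_{n,n}$ (so $m=n^2$), then, without any condition on uniqueness, $\Pr(\tau\ge t)\le C\,nm\phi/t$. -/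

import Mathlib

open MeasureTheory ProbabilityTheory

namespace MatchingBP

/-- A perfect matching of the complete bipartite graph on `u_1, …, u_n` and `v_1, …, v_n` is a
permutation `σ` (it matches `u_i` with `v_{σ i}`); this is its weight. -/
noncomputable def matchingWeight {n : ℕ} (w : Fin n → Fin n → ℝ) (σ : Equiv.Perm (Fin n)) : ℝ :=
  ∑ i, w i (σ i)

/-- `σ` is a maximum-weight perfect matching. -/
def IsMaxWeightMatching {n : ℕ} (w : Fin n → Fin n → ℝ) (σ : Equiv.Perm (Fin n)) : Prop :=
  ∀ π : Equiv.Perm (Fin n), matchingWeight w π ≤ matchingWeight w σ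

/-- The instance `w` has a unique optimum. -/
def HasUniqueOptimum {n : ℕ} (w : Fin n → Fin n → ℝ) : Prop :=
  ∃! σ : Equiv.Perm (Fin n), IsMaxWeightMatching w σ

/-- All messages of one iteration. `toV i j r` is the `r`-th entry of the message vector from `u_i`
to `v_j`, and `toU j i r` is the `r`-th entry of the message vector from `v_j` to `u_i`. -/
structure Messages (n : ℕ) where
  toV : Fin n → Fin n → Fin n → ℝ
  toU : Fin n → Fin n → Fin n → ℝ

/-- The initial messages. -/
noncomputable def initMessages {n : ℕ} (w : Fin n → Fin n → ℝ) : Messages n where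
  toV i j r := if r = i then w i j else 0
  toU j i r := if r = j then w i j else 0

/-- One round of message updates. The suprema are maxima over finite index sets. These sets are
non-empty wherever they are used: an `r ≠ i` exists only if `n ≥ 2`. -/
noncomputable def nextMessages {n : ℕ} (w : Fin n → Fin n → ℝ) (m : Messages n) :
    Messages n where
  toV i j r :=
    if r = i then w i j + ∑ k ∈ Finset.univ.erase j, m.toU k i j
    else ⨆ q : {q : Fin n // q ≠ j}, (w i q + ∑ k ∈ Finset.univ.erase j, m.toU k i q)
  toU j i r :=
    if r = j then w i j + ∑ k ∈ Finset.univ.erase i, m.toV k j i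
    else ⨆ q : {q : Fin n // q ≠ i}, (w q j + ∑ k ∈ Finset.univ.erase i, m.toV k j q)

/-- The messages in iteration `t`. -/
noncomputable def messages {n : ℕ} (w : Fin n → Fin n → ℝ) : ℕ → Messages n
  | 0 => initMessages w
  | t + 1 => nextMessages w (messages w t)

/-- The belief of node `u_i` in iteration `t` that it should be matched to `v_r`. -/
noncomputable def belief {n : ℕ} (w : Fin n → Fin n → ℝ) (t : ℕ) (i r : Fin n) : ℝ :=
  w i r + ∑ k, (messages w t).toU k i r

/-- The estimate in iteration `t` matches each `u_i` to the `v_r` with the largest belief.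
It equals `σ`, for every way of breaking ties, iff `σ i` is the unique maximizer of the belief of
`u_i`, for every `i`. -/
def EstimateEq {n : ℕ} (w : Fin n → Fin n → ℝ) (t : ℕ) (σ : Equiv.Perm (Fin n)) : Prop :=
  ∀ i r, r ≠ σ i → belief w t i r < belief w t i (σ i)

/-- The number of iterations until convergence: the least `T` such that from iteration `T` on the
estimate equals the maximum-weight perfect matching, and `⊤` if there is no such `T` (in
particular if there are two different maximum-weight perfect matchings). -/
noncomputable def convergenceTime {n : ℕ} (w : Fin n → Fin n → ℝ) : ℕ∞ :=
  sInf {T : ℕ∞ | ∃ T' : ℕ, T = T' ∧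
    ∀ s, T' ≤ s → ∀ σ, IsMaxWeightMatching w σ → EstimateEq w s σ}

/-- The weights on the complete bipartite graph that arise from weights on the edge set `E`:
missing edges are edges of weight `0`. -/
def completedWeights {n : ℕ} (E : Finset (Fin n × Fin n)) (x : E → ℝ) (i j : Fin n) : ℝ :=
  if h : (i, j) ∈ E then x ⟨(i, j), h⟩ else 0

/-- The law of `X` has a probability density `f : [0,1] → [0,φ]` (extended by `0`). -/
def HasDensityBoundedBy {Ω : Type*} [MeasurableSpace Ω] (P : Measure Ω) (X : Ω → ℝ) (φ : ℝ) :
    Prop :=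
  ∃ f : ℝ → ℝ, Measurable f ∧ (∀ x ∈ Set.Icc (0 : ℝ) 1, 0 ≤ f x ∧ f x ≤ φ) ∧
    (∀ x, x ∉ Set.Icc (0 : ℝ) 1 → f x = 0) ∧
    P.map X = volume.withDensity (fun x => ENNReal.ofReal (f x))

/-- The weights of the edges in `E` are drawn independently, each according to its own density
`[0,1] → [0,φ]`. -/
structure IsSmoothed {n : ℕ} (E : Finset (Fin n × Fin n)) {Ω : Type*} [MeasurableSpace Ω]
    (P : Measure Ω) (X : E → Ω → ℝ) (φ : ℝ) : Prop where
  measurable : ∀ e, Measurable (X e)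
  indep : iIndepFun X P
  density : ∀ e, HasDensityBoundedBy P (X e) φ

end MatchingBP

namespace MatchingBP

/-! Up to an additive constant each message vector takes two values, so the algorithm is a max-sum
recursion on directed edges (`messages_eq_scalarMessages`). If the optimum `σ` beats every other
matching by `n * δ`, raising all edges off `σ` by `δ` keeps it optimal, and LP duality gives
potentials with slack `δ` off `σ`. Measured against these, the edges of `σ` gain `δ` per iteration
(`scalarMessages_margin`), while each side's potentials vary by at most 2, so about `2 / δ`
iterations suffice.

Hence `τ ≥ t` forces a second-best matching within `4 * n / t` of the optimum. An edge in exactly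
one of the two has a weight that close to its tie threshold (`abs_sub_tieThreshold_le`). The
threshold depends only on the other weights, so by independence this has probability at most `8 * n
* φ / t`; a union bound over `E` finishes. -/

/-! ### Reduction to scalar messages -/

/-- The max-sum recursion behind the algorithm, with one number per directed edge: the first
component belongs to the messages from `u_i` to `v_j`, the second one to those from `v_j` to `u_i`
(both are indexed by `i j`). -/
noncomputable def scalarMessages {n : ℕ} (w : Fin n → Fin n → ℝ) :
    ℕ → (Fin n → Fin n → ℝ) × (Fin n → Fin n → ℝ)
  | 0 => (w, w)
  | t + 1 =>
    (fun i j => w i j - ⨆ q : {q : Fin n // q ≠ j}, (scalarMessages w t).2 i q,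
     fun i j => w i j - ⨆ q : {q : Fin n // q ≠ i}, (scalarMessages w t).1 q j)

lemma ciSup_two_mul_add {ι : Type*} [Finite ι] [Nonempty ι] (f : ι → ℝ) (S : ℝ) :
    ⨆ q, (2 * f q + S) = 2 * (⨆ q, f q) + S := by
  rw [Real.mul_iSup_of_nonneg (by norm_num), ciSup_add (Set.finite_range _).bddAbove]

lemma nonempty_ne_of_ne {α : Type*} {r i : α} (h : r ≠ i) (j : α) : Nonempty {q : α // q ≠ j} := by
  have : Nontrivial α := ⟨r, i, h⟩
  obtain ⟨q, hq⟩ := exists_ne j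
  exact ⟨q, hq⟩

/-- Up to an additive constant per message vector, the messages are given by the scalar ones. -/
lemma messages_eq_scalarMessages {n : ℕ} (w : Fin n → Fin n → ℝ) (t : ℕ) :
    ∃ c d : Fin n → Fin n → ℝ, ∀ i j r,
      (messages w t).toV i j r =
        (if r = i then 2 * (scalarMessages w t).1 i j - w i j else 0) + c i j ∧
      (messages w t).toU j i r =
        (if r = j then 2 * (scalarMessages w t).2 i j - w i j else 0) + d i j := by
  induction t with
  | zero =>
    refine ⟨0, 0, fun i j r => ⟨?_, ?_⟩⟩
    · simp only [messages, initMessages, scalarMessages]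
      split_ifs <;> simp <;> ring
    · simp only [messages, initMessages, scalarMessages]
      split_ifs <;> simp <;> ring
  | succ t ih =>
    obtain ⟨c, d, h⟩ := ih
    have hU : ∀ i j q, ∑ k ∈ Finset.univ.erase j, (messages w t).toU k i q =
        (if q ≠ j then 2 * (scalarMessages w t).2 i q - w i q else 0)
          + ∑ k ∈ Finset.univ.erase j, d i k := by
      intro i j q
      rw [Finset.sum_congr rfl fun k _ => (h i k q).2, Finset.sum_add_distrib, Finset.sum_ite_eq]
      simp
    have hV : ∀ i j q, ∑ k ∈ Finset.univ.erase i, (messages w t).toV k j q =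
        (if q ≠ i then 2 * (scalarMessages w t).1 q j - w q j else 0)
          + ∑ k ∈ Finset.univ.erase i, c k j := by
      intro i j q
      rw [Finset.sum_congr rfl fun k _ => (h k j q).1, Finset.sum_add_distrib, Finset.sum_ite_eq]
      simp
    refine ⟨fun i j => 2 * (⨆ q : {q : Fin n // q ≠ j}, (scalarMessages w t).2 i q)
        + ∑ k ∈ Finset.univ.erase j, d i k,
      fun i j => 2 * (⨆ q : {q : Fin n // q ≠ i}, (scalarMessages w t).1 q j)
        + ∑ k ∈ Finset.univ.erase i, c k j, fun i j r => ⟨?_, ?_⟩⟩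
    · simp only [messages, nextMessages, scalarMessages, hU]
      by_cases hr : r = i
      -- Here the supremum cancels, so its default value for `n = 1` is harmless.
      · simp [hr]; ring
      · have := nonempty_ne_of_ne hr j
        rw [if_neg hr, if_neg hr, ← ciSup_two_mul_add, zero_add]
        refine iSup_congr fun q => ?_
        simp [q.2]; ring
    · simp only [messages, nextMessages, scalarMessages, hV]
      by_cases hr : r = j
      · simp [hr]; ring
      · have := nonempty_ne_of_ne hr i
        rw [if_neg hr, if_neg hr, ← ciSup_two_mul_add, zero_add]
        refine iSup_congr fun q => ?_
        simp [q.2]; ring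

/-- The `- w i r` in the message from `v_r` cancels the weight in the belief, so both sides have the
same maximizers in `r`. -/
lemma belief_eq_scalarMessages {n : ℕ} (w : Fin n → Fin n → ℝ) (t : ℕ) (i : Fin n) :
    ∃ c : ℝ, ∀ r, belief w t i r = 2 * (scalarMessages w t).2 i r + c := by
  obtain ⟨_, d, h⟩ := messages_eq_scalarMessages w t
  refine ⟨∑ k, d i k, fun r => ?_⟩
  rw [belief, Finset.sum_congr rfl fun k _ => (h i k r).2, Finset.sum_add_distrib,
    Finset.sum_ite_eq]
  simp
  ring

/-! ### Growth of the margin -/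

/-- Under potentials that are tight on `σ` and have slack `δ` elsewhere, the advantage of the edges
of `σ` grows by `δ` per iteration. -/
lemma scalarMessages_margin {n : ℕ} {w : Fin n → Fin n → ℝ} {σ : Equiv.Perm (Fin n)}
    {p q : Fin n → ℝ} {δ D : ℝ} (htight : ∀ i, p i + q (σ i) = w i (σ i))
    (hslack : ∀ i j, j ≠ σ i → w i j + δ ≤ p i + q j)
    (hp : ∀ i k, p i ≤ p k + D) (hq : ∀ j k, q j ≤ q k + D) (t : ℕ) :
    ∀ i k j, j ≠ σ k →
      (t + 1) * δ - D ≤ ((scalarMessages w t).1 i (σ i) - q (σ i))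
        - ((scalarMessages w t).1 k j - q j) ∧
      (t + 1) * δ - D ≤ ((scalarMessages w t).2 i (σ i) - p i)
        - ((scalarMessages w t).2 k j - p k) := by
  induction t with
  | zero =>
    intro i k j hj
    have h1 := htight i
    have h2 := hslack k j hj
    have h3 := hp k i
    have h4 := hq j (σ i)
    simp only [scalarMessages, Nat.cast_zero]
    constructor <;> linarith
  | succ t ih =>
    intro i k j hj
    have h1 := htight i
    have h2 := hslack k j hj
    have hk : k ≠ σ.symm j := fun h => hj (by simp [h])
    push_cast
    simp only [scalarMessages]
    constructor
    -- Tightness at `i` and slack at `(k, j)` yield `δ` and trade `q` for `p`. The minus sign before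
    -- the suprema swaps `i` and `k`; `σ k` competes in the second supremum because `j ≠ σ k`.
    · have := nonempty_ne_of_ne hj (σ i)
      obtain ⟨l, hl⟩ := exists_eq_ciSup_of_finite
        (f := fun l : {l : Fin n // l ≠ σ i} => (scalarMessages w t).2 i l)
      have h5 := le_ciSup (Set.finite_range
        (fun l : {l : Fin n // l ≠ j} => (scalarMessages w t).2 k l)).bddAbove ⟨σ k, hj.symm⟩
      have h6 := (ih k i l l.2).2
      rw [← hl]
      simp only at h5
      linarith
    · have := nonempty_ne_of_ne hk i
      obtain ⟨l, hl⟩ := exists_eq_ciSup_of_finite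
        (f := fun l : {l : Fin n // l ≠ i} => (scalarMessages w t).1 l (σ i))
      have h5 := le_ciSup (Set.finite_range
        (fun l : {l : Fin n // l ≠ k} => (scalarMessages w t).1 l j)).bddAbove
          ⟨σ.symm j, hk.symm⟩
      have h6 := (ih (σ.symm j) l (σ i) (fun h => l.2 (σ.injective h).symm)).1
      rw [← hl]
      simp only [Equiv.apply_symm_apply] at h5 h6
      linarith

/-! ### Dual potentials via Birkhoff's theorem -/

/-- A nonnegative circulation has nonpositive value for the gains `w i j - w j j` if the identity
is a maximum-weight matching. -/
lemma circulation_value_nonpos {ι : Type*} [Fintype ι] [DecidableEq ι] {w : ι → ι → ℝ}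
    (hw : ∀ π : Equiv.Perm ι, ∑ i, w i (π i) ≤ ∑ i, w i i) {N : ι → ι → ℝ}
    (hN : ∀ i j, 0 ≤ N i j) (hcirc : ∀ i, ∑ j, N i j = ∑ j, N j i) :
    ∑ i, ∑ j, N i j * (w i j - w j j) ≤ 0 := by
  set K : ℝ := 1 + ∑ i, ∑ j, N i j with hK
  have hrow : ∀ i, 0 ≤ ∑ j, N i j := fun i => Finset.sum_nonneg fun j _ => hN i j
  have hle : ∀ i, ∑ j, N i j ≤ K := fun i => by
    have := Finset.single_le_sum (fun i _ => hrow i) (Finset.mem_univ i)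
    linarith
  have hK0 : 0 < K := by
    have := Finset.sum_nonneg fun i (_ : i ∈ Finset.univ) => hrow i
    linarith
  -- Diagonal entries have gain zero, so padding the diagonal up to row sum `K` is free and gives a
  -- doubly stochastic matrix, a mixture of permutations.
  let M : Matrix ι ι ℝ := fun i j => (N i j + if i = j then K - ∑ k, N i k else 0) / K
  have hM : M ∈ doublyStochastic ℝ ι := by
    rw [mem_doublyStochastic_iff_sum]
    refine ⟨fun i j => ?_, fun i => ?_, fun j => ?_⟩
    · refine div_nonneg (add_nonneg (hN i j) ?_) hK0.le
      split_ifs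
      · linarith [hle i]
      · exact le_rfl
    · simp only [M]
      rw [← Finset.sum_div, Finset.sum_add_distrib, Finset.sum_ite_eq]
      simp [hK0.ne']
    · simp only [M]
      rw [← Finset.sum_div, Finset.sum_add_distrib, Finset.sum_ite_eq']
      simp [hcirc j, hK0.ne']
  obtain ⟨c, hc0, hc1, hcM⟩ := exists_eq_sum_perm_of_mem_doublyStochastic hM
  have hval : ∑ i, ∑ j, M i j * (w i j - w j j) ≤ 0 := by
    have : ∀ i j, M i j = ∑ π : Equiv.Perm ι, c π * (if π i = j then 1 else 0) := by
      intro i j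
      rw [← hcM, Matrix.sum_apply]
      simp [Equiv.Perm.permMatrix, PEquiv.toMatrix_apply, Equiv.toPEquiv_apply, eq_comm]
    calc ∑ i, ∑ j, M i j * (w i j - w j j)
        = ∑ π : Equiv.Perm ι, c π * ∑ i, (w i (π i) - w (π i) (π i)) := by
          simp_rw [this, Finset.sum_mul, Finset.mul_sum]
          rw [Finset.sum_comm (s := (Finset.univ : Finset (Equiv.Perm ι)))]
          refine Finset.sum_congr rfl fun i _ => ?_
          rw [Finset.sum_comm]
          simp
      _ ≤ 0 := by
          refine Finset.sum_nonpos fun π _ => mul_nonpos_of_nonneg_of_nonpos (hc0 π) ?_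
          rw [Finset.sum_sub_distrib, Equiv.sum_comp π fun i => w i i]
          linarith [hw π]
  have heq : ∑ i, ∑ j, N i j * (w i j - w j j) = K * ∑ i, ∑ j, M i j * (w i j - w j j) := by
    simp_rw [Finset.mul_sum]
    refine Finset.sum_congr rfl fun i _ => Finset.sum_congr rfl fun j _ => ?_
    simp only [M]
    split_ifs with h
    · subst h; simp
    · field_simp; ring
  rw [heq]
  exact mul_nonpos_of_nonneg_of_nonpos hK0.le hval

/-- Dual potentials for the assignment problem whose optimum is the identity. -/
lemma exists_potentials_of_identity {ι : Type*} [Fintype ι] [DecidableEq ι] {w : ι → ι → ℝ}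
    (hw : ∀ π : Equiv.Perm ι, ∑ i, w i (π i) ≤ ∑ i, w i i) :
    ∃ p : ι → ℝ, ∀ i j, w i j - w j j + p j ≤ p i := by
  rcases isEmpty_or_nonempty ι with _ | ⟨⟨o⟩⟩
  · exact ⟨0, fun i => isEmptyElim i⟩
  -- Unit flows from `i` to `o`; their largest value acts as a longest-path distance.
  let F : ι → Set (ι → ι → ℝ) := fun i => {N | (∀ k j, 0 ≤ N k j) ∧
    ∀ k, ∑ j, N k j + (if k = o then 1 else 0) = ∑ j, N j k + (if k = i then 1 else 0)}
  let v : (ι → ι → ℝ) → ℝ := fun N => ∑ i, ∑ j, N i j * (w i j - w j j)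
  let e : ι → ι → ι → ι → ℝ := fun i j k l => if k = i then (if l = j then 1 else 0) else 0
  have he0 : ∀ i j k l, 0 ≤ e i j k l := fun i j k l => by
    simp only [e]; split_ifs <;> norm_num
  have hrow : ∀ i j k, ∑ l, e i j k l = if k = i then 1 else 0 := fun i j k => by
    simp only [e]; split_ifs <;> simp
  have hcol : ∀ i j k, ∑ l, e i j l k = if k = j then 1 else 0 := fun i j k => by
    simp [e]
  have hv : ∀ N i j, v (N + e i j) = v N + (w i j - w j j) := by
    intro N i j
    simp only [v, Pi.add_apply, add_mul, Finset.sum_add_distrib]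
    simp [e, ite_mul]
  -- The edge from `o` to `i` closes such a flow into a circulation.
  have hbdd : ∀ i, BddAbove (v '' F i) := by
    intro i
    refine ⟨-(w o i - w i i), ?_⟩
    rintro _ ⟨N, ⟨hN, hNc⟩, rfl⟩
    have := circulation_value_nonpos hw (N := N + e o i)
      (fun k l => add_nonneg (hN k l) (he0 o i k l)) (fun k => by
        simp only [Pi.add_apply, Finset.sum_add_distrib, hrow, hcol, hNc k])
    have h2 := hv N o i
    simp only [v] at h2 ⊢
    linarith
  refine ⟨fun i => sSup (v '' F i), fun i j => ?_⟩
  have hne : (F j).Nonempty := by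
    refine ⟨e j o, he0 j o, fun k => ?_⟩
    rw [hrow, hcol, add_comm]
  rw [← le_sub_iff_add_le']
  refine csSup_le (hne.image v) ?_
  rintro _ ⟨N, ⟨hN, hNc⟩, rfl⟩
  rw [le_sub_iff_add_le', add_comm, ← hv]
  refine le_csSup (hbdd i) ⟨_, ⟨fun k l => add_nonneg (hN k l) (he0 i j k l), fun k => ?_⟩, rfl⟩
  have := hNc k
  simp only [Finset.sum_add_distrib, hrow, hcol]
  linarith

/-- If `σ` beats every other matching by `n * δ`, there are potentials with slack `δ` off `σ`. -/
lemma exists_potentials {n : ℕ} {w : Fin n → Fin n → ℝ} (hw0 : ∀ i j, 0 ≤ w i j)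
    (hw1 : ∀ i j, w i j ≤ 1) {σ : Equiv.Perm (Fin n)} {δ : ℝ} (hδ : 0 ≤ δ)
    (hgap : ∀ π, π ≠ σ → matchingWeight w π + n * δ ≤ matchingWeight w σ) :
    ∃ p q : Fin n → ℝ, (∀ i, p i + q (σ i) = w i (σ i)) ∧
      (∀ i j, j ≠ σ i → w i j + δ ≤ p i + q j) ∧
      (∀ i k, p i ≤ p k + 2) ∧ (∀ j k, q j ≤ q k + 2) := by
  obtain ⟨p, hp⟩ := exists_potentials_of_identity
    (w := fun i k => w i (σ k) + if k = i then 0 else δ) (fun π => by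
      rcases eq_or_ne π 1 with rfl | hπ
      · simp
      have h1 := hgap (σ * π) (by simpa using hπ)
      have h2 : ∑ i, (if π i = i then 0 else δ) ≤ ∑ _i : Fin n, δ :=
        Finset.sum_le_sum fun i _ => by split_ifs <;> linarith
      simp only [matchingWeight, Equiv.Perm.mul_apply] at h1
      simp only [Finset.sum_add_distrib]
      simp at h2 ⊢
      linarith)
  have hspread : ∀ i k, p k ≤ p i + 1 := fun i k => by
    have h := hp i k
    have h0 := hw0 i (σ k)
    have h1 := hw1 k (σ k)
    rcases eq_or_ne k i with rfl | hne
    · linarith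
    · rw [if_neg hne, if_pos rfl] at h
      linarith
  -- Tightness forces `q`. Its spread 2 is 1 from the weights plus 1 from `p`.
  refine ⟨p, fun j => w (σ.symm j) j - p (σ.symm j), fun i => by simp, fun i j hj => ?_,
    fun i k => by linarith [hspread k i], fun j k => ?_⟩
  · have h := hp i (σ.symm j)
    have hne : σ.symm j ≠ i := fun h => hj (by simp [← h])
    simp [hne] at h
    linarith
  · have h1 := hspread (σ.symm j) (σ.symm k)
    have h2 := hw0 (σ.symm k) k
    have h3 := hw1 (σ.symm j) j
    simp only
    linarith

/-! ### Convergence from an optimality gap -/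

lemma estimateEq_of_gap {n : ℕ} {w : Fin n → Fin n → ℝ} (hw0 : ∀ i j, 0 ≤ w i j)
    (hw1 : ∀ i j, w i j ≤ 1) {σ : Equiv.Perm (Fin n)} {δ : ℝ} (hδ : 0 ≤ δ)
    (hgap : ∀ π, π ≠ σ → matchingWeight w π + n * δ ≤ matchingWeight w σ) {s : ℕ}
    (hs : 2 < (s + 1) * δ) : EstimateEq w s σ := by
  obtain ⟨p, q, htight, hslack, hp, hq⟩ := exists_potentials hw0 hw1 hδ hgap
  intro i r hr
  obtain ⟨c, hc⟩ := belief_eq_scalarMessages w s i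
  have := (scalarMessages_margin htight hslack hp hq s i i r hr).2
  rw [hc, hc]
  linarith

/-- If the algorithm has not converged before iteration `t`, then some matching other than the
optimum is nearly optimal; we may take a best one. -/
lemma exists_near_optimum {n : ℕ} {w : Fin n → Fin n → ℝ} (hw0 : ∀ i j, 0 ≤ w i j)
    (hw1 : ∀ i j, w i j ≤ 1) {t : ℕ} (ht : 0 < t) (hτ : (t : ℕ∞) ≤ convergenceTime w) :
    ∃ σ π : Equiv.Perm (Fin n), IsMaxWeightMatching w σ ∧ π ≠ σ ∧
      (∀ ρ, ρ ≠ σ → matchingWeight w ρ ≤ matchingWeight w π) ∧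
      matchingWeight w σ ≤ matchingWeight w π + 4 * n / t := by
  have ht' : (0 : ℝ) < t := by exact_mod_cast ht
  have hnot : ∃ s, t - 1 ≤ s ∧ ∃ σ, IsMaxWeightMatching w σ ∧ ¬ EstimateEq w s σ := by
    by_contra! h
    have h1 : convergenceTime w ≤ ((t - 1 : ℕ) : ℕ∞) := sInf_le ⟨t - 1, rfl, h⟩
    have h2 := hτ.trans h1
    rw [Nat.cast_le] at h2
    omega
  obtain ⟨s, hs, σ, hσ, hne⟩ := hnot
  have hst : (t : ℝ) ≤ s + 1 := by exact_mod_cast (by omega : t ≤ s + 1)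
  obtain ⟨ρ, hρ, hρgap⟩ : ∃ ρ, ρ ≠ σ ∧
      matchingWeight w σ < matchingWeight w ρ + 4 * n / t := by
    by_contra! h
    -- As `t ≤ s + 1`, this `δ` gives `(s + 1) * δ ≥ 4 > 2`.
    refine hne (estimateEq_of_gap hw0 hw1 (δ := 4 / t) (by positivity) (fun π hπ => ?_) ?_)
    · have := h π hπ
      rwa [show (n : ℝ) * (4 / t) = 4 * n / t by ring]
    · rw [← mul_div_assoc, lt_div_iff₀ ht']
      linarith
  obtain ⟨π, hπ, hmax⟩ := Finset.exists_max_image (Finset.univ.filter (· ≠ σ))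
    (matchingWeight w) ⟨ρ, by simpa using hρ⟩
  simp only [Finset.mem_filter, Finset.mem_univ, true_and] at hπ hmax
  exact ⟨σ, π, hσ, hπ, hmax, by linarith [hmax ρ hρ]⟩

/-! ### Tie thresholds of edges -/

/-- The weight of edge `e` at which the best matchings with and without `e` tie, if the weights of
the other edges are given by `x` and `x e = 0`. -/
noncomputable def tieThreshold {n : ℕ} (E : Finset (Fin n × Fin n)) (e : E) (x : E → ℝ) : ℝ :=
  (⨆ π : {π : Equiv.Perm (Fin n) // π e.1.1 ≠ e.1.2}, matchingWeight (completedWeights E x) π)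
    - ⨆ π : {π : Equiv.Perm (Fin n) // π e.1.1 = e.1.2}, matchingWeight (completedWeights E x) π

lemma matchingWeight_update {n : ℕ} (E : Finset (Fin n × Fin n)) (e : E) (x : E → ℝ)
    (π : Equiv.Perm (Fin n)) :
    matchingWeight (completedWeights E (Function.update x e 0)) π =
      matchingWeight (completedWeights E x) π - if π e.1.1 = e.1.2 then x e else 0 := by
  have h : ∀ i, completedWeights E (Function.update x e 0) i (π i) =
      completedWeights E x i (π i) - if i = e.1.1 then (if π e.1.1 = e.1.2 then x e else 0) else 0 := by
    intro i
    obtain ⟨⟨a, b⟩, hab⟩ := e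
    unfold completedWeights
    by_cases hi : i = a
    · subst hi
      by_cases hb : π i = b
      · subst hb
        simp [hab]
      · simp [hb]
    · simp [hi]
  simp [matchingWeight, h, Finset.sum_sub_distrib]

/-- Resetting `x e` to 0 lowers all matchings through `e` equally and leaves the others alone, so
`σ` and `π` stay best in their classes. -/
lemma sub_tieThreshold {n : ℕ} {E : Finset (Fin n × Fin n)} {e : E} {x : E → ℝ}
    {σ π : Equiv.Perm (Fin n)} (hσ : σ e.1.1 = e.1.2) (hπ : π e.1.1 ≠ e.1.2)
    (hσmax : ∀ ρ : Equiv.Perm (Fin n), ρ e.1.1 = e.1.2 →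
      matchingWeight (completedWeights E x) ρ ≤ matchingWeight (completedWeights E x) σ)
    (hπmax : ∀ ρ : Equiv.Perm (Fin n), ρ e.1.1 ≠ e.1.2 →
      matchingWeight (completedWeights E x) ρ ≤ matchingWeight (completedWeights E x) π) :
    x e - tieThreshold E e (Function.update x e 0) =
      matchingWeight (completedWeights E x) σ - matchingWeight (completedWeights E x) π := by
  have h1 : ⨆ ρ : {ρ : Equiv.Perm (Fin n) // ρ e.1.1 = e.1.2},
      matchingWeight (completedWeights E (Function.update x e 0)) ρ =
        matchingWeight (completedWeights E x) σ - x e := by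
    have : Nonempty {ρ : Equiv.Perm (Fin n) // ρ e.1.1 = e.1.2} := ⟨⟨σ, hσ⟩⟩
    refine ciSup_eq_of_forall_le_of_forall_lt_exists_gt (fun ρ => ?_) fun y hy => ⟨⟨σ, hσ⟩, ?_⟩
    · rw [matchingWeight_update, if_pos ρ.2]
      linarith [hσmax ρ ρ.2]
    · rwa [matchingWeight_update, if_pos hσ]
  have h0 : ⨆ ρ : {ρ : Equiv.Perm (Fin n) // ρ e.1.1 ≠ e.1.2},
      matchingWeight (completedWeights E (Function.update x e 0)) ρ =
        matchingWeight (completedWeights E x) π := by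
    have : Nonempty {ρ : Equiv.Perm (Fin n) // ρ e.1.1 ≠ e.1.2} := ⟨⟨π, hπ⟩⟩
    refine ciSup_eq_of_forall_le_of_forall_lt_exists_gt (fun ρ => ?_) fun y hy => ⟨⟨π, hπ⟩, ?_⟩
    · rw [matchingWeight_update, if_neg ρ.2, sub_zero]
      exact hπmax ρ ρ.2
    · rwa [matchingWeight_update, if_neg hπ, sub_zero]
  rw [tieThreshold, h1, h0]
  ring

/-- An edge in exactly one of the optimum and the second-best matching has a weight close to its
tie threshold. -/
lemma abs_sub_tieThreshold_le {n : ℕ} {E : Finset (Fin n × Fin n)} {x : E → ℝ}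
    {σ π : Equiv.Perm (Fin n)} {ε : ℝ} (hσ : IsMaxWeightMatching (completedWeights E x) σ)
    (hπ : ∀ ρ, ρ ≠ σ →
      matchingWeight (completedWeights E x) ρ ≤ matchingWeight (completedWeights E x) π)
    (hgap : matchingWeight (completedWeights E x) σ ≤
      matchingWeight (completedWeights E x) π + ε) {e : E}
    (he : ¬ (σ e.1.1 = e.1.2 ↔ π e.1.1 = e.1.2)) :
    |x e - tieThreshold E e (Function.update x e 0)| ≤ ε := by
  have hπσ := hσ π
  -- `σ` is best overall, and `π` is best in its class because that class excludes `σ`.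
  by_cases h : σ e.1.1 = e.1.2
  · have h' : π e.1.1 ≠ e.1.2 := fun h' => he (iff_of_true h h')
    rw [sub_tieThreshold h h' (fun ρ _ => hσ ρ) fun ρ hρ => hπ ρ fun hh => hρ (hh ▸ h)]
    rw [abs_le]
    constructor <;> linarith
  · have h' : π e.1.1 = e.1.2 := by tauto
    rw [sub_tieThreshold h' h (fun ρ hρ => hπ ρ fun hh => h (hh ▸ hρ)) fun ρ _ => hσ ρ]
    rw [abs_le]
    constructor <;> linarith

/-- Two matchings that share their edges in `E` have the same weight. -/
lemma matchingWeight_eq_of_agree {n : ℕ} {E : Finset (Fin n × Fin n)} (x : E → ℝ)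
    {σ π : Equiv.Perm (Fin n)} (h : ∀ e : E, σ e.1.1 = e.1.2 ↔ π e.1.1 = e.1.2) :
    matchingWeight (completedWeights E x) σ = matchingWeight (completedWeights E x) π := by
  refine Finset.sum_congr rfl fun i _ => ?_
  unfold completedWeights
  by_cases h1 : (i, σ i) ∈ E
  · have := (h ⟨_, h1⟩).1 rfl
    simp only at this
    rw [this]
  · by_cases h2 : (i, π i) ∈ E
    · have := (h ⟨_, h2⟩).2 rfl
      simp only at this
      rw [this]
    · rw [dif_neg h1, dif_neg h2]

lemma measurable_tieThreshold {n : ℕ} (E : Finset (Fin n × Fin n)) (e : E) :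
    Measurable (tieThreshold E e) := by
  have h : ∀ π : Equiv.Perm (Fin n),
      Measurable fun x : E → ℝ => matchingWeight (completedWeights E x) π := by
    intro π
    refine Finset.measurable_sum _ fun i _ => ?_
    unfold completedWeights
    split_ifs
    · exact measurable_pi_apply _
    · exact measurable_const
  exact (Measurable.iSup fun π : {π : Equiv.Perm (Fin n) // π e.1.1 ≠ e.1.2} => h π).sub
    (Measurable.iSup fun π : {π : Equiv.Perm (Fin n) // π e.1.1 = e.1.2} => h π)

/-! ### Probability of a near tie -/

lemma HasDensityBoundedBy.map_le {Ω : Type*} [MeasurableSpace Ω] {P : Measure Ω} {X : Ω → ℝ}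
    {φ : ℝ} (h : HasDensityBoundedBy P X φ) {s : Set ℝ} (hs : MeasurableSet s) :
    P.map X s ≤ ENNReal.ofReal φ * volume s := by
  obtain ⟨f, -, hf, hf0, hmap⟩ := h
  rw [hmap, withDensity_apply _ hs, ← setLIntegral_const]
  refine lintegral_mono fun x => ?_
  by_cases hx : x ∈ Set.Icc (0 : ℝ) 1
  · exact ENNReal.ofReal_le_ofReal (hf x hx).2
  · simp [hf0 x hx]

lemma HasDensityBoundedBy.ae_mem_Icc {Ω : Type*} [MeasurableSpace Ω] {P : Measure Ω} {X : Ω → ℝ}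
    {φ : ℝ} (h : HasDensityBoundedBy P X φ) (hX : Measurable X) :
    ∀ᵐ ω ∂P, X ω ∈ Set.Icc (0 : ℝ) 1 := by
  obtain ⟨f, -, -, hf0, hmap⟩ := h
  refine ae_of_ae_map hX.aemeasurable (p := fun x => x ∈ Set.Icc (0 : ℝ) 1) ?_
  rw [ae_iff, hmap]
  change volume.withDensity _ (Set.Icc (0 : ℝ) 1)ᶜ = 0
  rw [withDensity_apply _ measurableSet_Icc.compl]
  refine (setLIntegral_congr_fun measurableSet_Icc.compl fun x hx => ?_).trans lintegral_zero
  simp [hf0 x hx]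

/-- A random variable with bounded density is unlikely to be close to an independent one. -/
lemma HasDensityBoundedBy.measure_abs_sub_le {Ω : Type*} [MeasurableSpace Ω] {P : Measure Ω}
    [IsProbabilityMeasure P] {X Z : Ω → ℝ} {φ : ℝ} (h : HasDensityBoundedBy P X φ)
    (hX : Measurable X) (hZ : Measurable Z) (hind : IndepFun Z X P) (ε : ℝ) :
    P {ω | |X ω - Z ω| ≤ ε} ≤ ENNReal.ofReal φ * ENNReal.ofReal (2 * ε) := by
  have hS : MeasurableSet {y : ℝ × ℝ | |y.2 - y.1| ≤ ε} :=
    measurableSet_le (measurable_snd.sub measurable_fst).abs measurable_const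
  have := Measure.isProbabilityMeasure_map (μ := P) hZ.aemeasurable
  have := Measure.isProbabilityMeasure_map (μ := P) hX.aemeasurable
  have hprod := (indepFun_iff_map_prod_eq_prod_map_map hZ.aemeasurable hX.aemeasurable).1 hind
  calc P {ω | |X ω - Z ω| ≤ ε}
      = P.map (fun ω => (Z ω, X ω)) {y : ℝ × ℝ | |y.2 - y.1| ≤ ε} := by
        rw [Measure.map_apply (hZ.prodMk hX) hS]; rfl
    _ = ∫⁻ z, P.map X (Prod.mk z ⁻¹' {y : ℝ × ℝ | |y.2 - y.1| ≤ ε}) ∂P.map Z := by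
        rw [hprod, Measure.prod_apply hS]
    _ ≤ ∫⁻ _z, ENNReal.ofReal φ * ENNReal.ofReal (2 * ε) ∂P.map Z := by
        refine lintegral_mono fun z => ?_
        have hz : Prod.mk z ⁻¹' {y : ℝ × ℝ | |y.2 - y.1| ≤ ε} = Set.Icc (z - ε) (z + ε) := by
          ext y
          simp only [Set.mem_preimage, Set.mem_ofPred_eq, Set.mem_Icc, abs_le]
          constructor <;> rintro ⟨h1, h2⟩ <;> constructor <;> linarith
        rw [hz]
        refine (h.map_le measurableSet_Icc).trans_eq ?_
        rw [Real.volume_Icc]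
        ring_nf
    _ = ENNReal.ofReal φ * ENNReal.ofReal (2 * ε) := by simp

lemma IsSmoothed.measure_abs_sub_tieThreshold_le {n : ℕ} {E : Finset (Fin n × Fin n)} {Ω : Type*}
    [MeasurableSpace Ω] {P : Measure Ω} [IsProbabilityMeasure P] {X : E → Ω → ℝ} {φ : ℝ}
    (h : IsSmoothed E P X φ) (e : E) (ε : ℝ) :
    P {ω | |X e ω - tieThreshold E e (Function.update (fun e => X e ω) e 0)| ≤ ε} ≤
      ENNReal.ofReal φ * ENNReal.ofReal (2 * ε) := by
  -- After the reset the threshold is a function of the coordinates in `T`, hence independent of `X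
  -- e`.
  let T : Finset E := {e}ᶜ
  let G : (T → ℝ) → E → ℝ := fun y e' => if h : e' ∈ T then y ⟨e', h⟩ else 0
  have hG : Measurable G := by
    refine measurable_pi_lambda _ fun e' => ?_
    simp only [G]
    split_ifs
    · exact measurable_pi_apply _
    · exact measurable_const
  have hGX : ∀ ω, Function.update (fun e => X e ω) e 0 = G fun e' : T => X e' ω := by
    intro ω
    ext e'
    by_cases he : e' = e
    · subst he; simp [G, T]
    · simp [G, T, he]
  have hZ := (measurable_tieThreshold E e).comp hG
  have hind : IndepFun (fun ω => tieThreshold E e (G fun e' : T => X e' ω)) (X e) P :=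
    (h.indep.indepFun_finset T {e} (by simp [T, Finset.disjoint_left]) h.measurable).comp
      (ψ := fun y : ({e} : Finset E) → ℝ => y ⟨e, Finset.mem_singleton_self e⟩) hZ
      (measurable_pi_apply _)
  simp only [hGX]
  exact (h.density e).measure_abs_sub_le (h.measurable e)
    (hZ.comp (measurable_pi_lambda _ fun e' => h.measurable e')) hind ε

/-- The isolation bound: some edge is within `ε` of its tie threshold. -/
lemma IsSmoothed.measure_exists_near_tie_le {n : ℕ} {E : Finset (Fin n × Fin n)} {Ω : Type*}
    [MeasurableSpace Ω] {P : Measure Ω} [IsProbabilityMeasure P] {X : E → Ω → ℝ} {φ : ℝ}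
    (h : IsSmoothed E P X φ) {t : ℕ} {A : Set Ω}
    (hA : ∀ ω ∈ A, (∀ e, X e ω ∈ Set.Icc (0 : ℝ) 1) → ∃ e,
      |X e ω - tieThreshold E e (Function.update (fun e => X e ω) e 0)| ≤ 4 * n / t) :
    P A ≤ ENNReal.ofReal (8 * (n * E.card * φ / t)) := by
  have hae : ∀ᵐ ω ∂P, ∀ e, X e ω ∈ Set.Icc (0 : ℝ) 1 :=
    ae_all_iff.2 fun e => (h.density e).ae_mem_Icc (h.measurable e)
  calc P A ≤ P (⋃ e, {ω | |X e ω - tieThreshold E e (Function.update (fun e => X e ω) e 0)|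
        ≤ 4 * n / t}) := by
        refine measure_mono_ae ?_
        filter_upwards [hae] with ω hω hωA
        exact Set.mem_iUnion.2 (hA ω hωA hω)
    _ ≤ ∑ e, P {ω | |X e ω - tieThreshold E e (Function.update (fun e => X e ω) e 0)|
        ≤ 4 * n / t} := measure_iUnion_fintype_le _ _
    _ ≤ ∑ _e : E, ENNReal.ofReal φ * ENNReal.ofReal (2 * (4 * n / t)) :=
        Finset.sum_le_sum fun e _ => h.measure_abs_sub_tieThreshold_le e _
    _ = ENNReal.ofReal (8 * (n * E.card * φ / t)) := by
        rw [Finset.sum_const, Finset.card_univ, Fintype.card_coe, nsmul_eq_mul,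
          ← ENNReal.ofReal_natCast, ← ENNReal.ofReal_mul' (by positivity),
          ← ENNReal.ofReal_mul (by positivity)]
        congr 1
        ring

lemma completedWeights_mem_Icc {n : ℕ} {E : Finset (Fin n × Fin n)} {x : E → ℝ}
    (hx : ∀ e, x e ∈ Set.Icc (0 : ℝ) 1) (i j : Fin n) :
    completedWeights E x i j ∈ Set.Icc (0 : ℝ) 1 := by
  unfold completedWeights
  split_ifs
  · exact hx _
  · simp

end MatchingBP

theorem mainTheorem4 :
    ∃ C : ℝ, 0 < C ∧
      ∀ (n : ℕ) (E : Finset (Fin n × Fin n)) (φ : ℝ)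
        (Ω : Type*) [MeasurableSpace Ω] (P : MeasureTheory.Measure Ω)
        [MeasureTheory.IsProbabilityMeasure P] (X : E → Ω → ℝ),
        MatchingBP.IsSmoothed E P X φ →
        ∀ t : ℕ, 0 < t →
          P {ω | MatchingBP.HasUniqueOptimum
                    (MatchingBP.completedWeights E (fun e => X e ω)) ∧
                  (t : ℕ∞) ≤ MatchingBP.convergenceTime
                    (MatchingBP.completedWeights E (fun e => X e ω))}
              ≤ ENNReal.ofReal (C * (n * E.card * φ / t)) ∧
          (E = Finset.univ →
            P {ω | (t : ℕ∞) ≤ MatchingBP.convergenceTime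
                    (MatchingBP.completedWeights E (fun e => X e ω))}
              ≤ ENNReal.ofReal (C * (n * E.card * φ / t))) := by
  refine ⟨8, by norm_num, fun n E φ Ω _ P _ X h t ht => ⟨?_, fun hE => ?_⟩⟩
  · refine h.measure_exists_near_tie_le ?_
    rintro ω ⟨⟨σ₀, -, huniq⟩, hτ⟩ hω
    have hw := MatchingBP.completedWeights_mem_Icc hω
    obtain ⟨σ, π, hσ, hne, hπ, hgap⟩ := MatchingBP.exists_near_optimum
      (fun i j => (hw i j).1) (fun i j => (hw i j).2) ht hτ
    obtain ⟨e, he⟩ : ∃ e : E, ¬ (σ e.1.1 = e.1.2 ↔ π e.1.1 = e.1.2) := by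
      -- Matchings that differ only in missing edges tie, which uniqueness excludes.
      by_contra! hagree
      have heq := MatchingBP.matchingWeight_eq_of_agree (fun e => X e ω) hagree
      exact hne ((huniq π fun ρ => (hσ ρ).trans_eq heq).trans (huniq σ hσ).symm)
    exact ⟨e, MatchingBP.abs_sub_tieThreshold_le hσ hπ hgap he⟩
  · refine h.measure_exists_near_tie_le ?_
    intro ω hτ hω
    have hw := MatchingBP.completedWeights_mem_Icc hω
    obtain ⟨σ, π, hσ, hne, hπ, hgap⟩ := MatchingBP.exists_near_optimum
      (fun i j => (hw i j).1) (fun i j => (hw i j).2) ht hτ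
    -- With no missing edges any difference lies in `E`, even if `σ` and `π` tie.
    obtain ⟨i, hi⟩ : ∃ i, π i ≠ σ i := by
      by_contra! hagree
      exact hne (Equiv.ext hagree)
    exact ⟨⟨(i, σ i), hE ▸ Finset.mem_univ _⟩,
      MatchingBP.abs_sub_tieThreshold_le hσ hπ hgap (by simpa using hi)⟩
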